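/- Let $\Sigma=\{0,1\}$ and let $\Sigma^*$ be the set of finite non-empty strings over $\Sigma$. A promise problem is a function $\phi$ that assigns to each $x\in\Sigma^*$ a non-empty set $\phi(x)\subseteq\Sigma$ of valid answers; a function $\phi:\Sigma^*\to\Sigma$ is regarded as the promise problem $x\mapsto\{\phi(x)\}$. Write $\phi_1\propto\phi_2$ if there is a function $\mu:\Sigma^*\to\Sigma^*$, computable by a Turing machine in time polynomial in the length of its input, with $\phi_1(x)\supseteq\phi_2(\mu(x))$ for all $x\in\Sigma^*$, and let $[\phi]=\{\psi\mid\psi\propto\phi\}$ be the strong closure of $\phi$. Let $n\ge 1$. The following problems take as input (the encoding of) a function $f:\Sigma^{m_1}\times\cdots\times\Sigma^{m_n}\to\Sigma$ with all $m_i\ge1$, given by $m_1,\dots,m_n$ in binary and by a Boolean expression in $\land,\lor,\lnot$; for $x\in\Sigma^{m_1}$ let $f_x$ be the function of the remaining $n-1$ blocks obtained by fixing the first block to be $x$. (The encoding is chosen so that every string encodes some $f$.) - $\mathrm{SAT}_n(f)=1$ if and only if $\overline{\mathrm{SAT}}_{n-1}(f_x)=1$ for some $x\in\Sigma^{m_1}$;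 - $\overline{\mathrm{SAT}}_n(f)=1$ if and only if $\mathrm{SAT}_{n-1}(f_x)=1$ for all $x\in\Sigma^{m_1}$; - $\mathrm{VAL}_n(f)=\{x_1\mid x\in\Sigma^{m_1},\ \overline{\mathrm{SAT}}_{n-1}(f_x)=1\}$, where $x_1$ is the first bit of $x$, if $\mathrm{SAT}_n(f)=1$, and $\mathrm{VAL}_n(f)=\Sigma$ otherwise. Here, for a function $f$ of no blocks, that is, a constant $f\in\Sigma$, $\mathrm{SAT}_0(f)=\overline{\mathrm{SAT}}_0(f)=f$. Put $\widehat\Sigma_n=[\mathrm{SAT}_n]$ (promise-$\Sigma_n$), $\widehat\Pi_n=[\overline{\mathrm{SAT}}_n]$ (promise-$\Pi_n$) and $\widehat{\mathrm V}_n=[\mathrm{VAL}_n]$. **Theorem.** For every $n\ge1$, $$\widehat{\mathrm V}_n=\widehat\Sigma_n\cap\widehat\Pi_n .$$ In particular $\mathrm{VAL}_n$ is complete for $\widehat\Sigma_n\cap\widehat\Pi_n$: it belongs to this class, and $\phi\propto\mathrm{VAL}_n$ for every $\phi$ in it. For $n=1$ this says that $\mathrm{VAL}=\mathrm{VAL}_1$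 is complete for promise-$(\mathrm{NP}\cap\mathrm{coNP})=\widehat\Sigma_1\cap\widehat\Pi_1$. -/

import Mathlib

namespace PromiseHierarchy

/-! ### Strings, problems and promise problems -/

/-- Finite non-empty strings over the alphabet of the two letters 0 = `false` and 1 = `true`. -/
abbrev Word : Type := {w : List Bool // w ≠ []}

/-- The non-empty subsets of the alphabet. -/
abbrev Answers : Type := {S : Set Bool // S.Nonempty}

/-- A non-promise problem. -/
abbrev Problem : Type := Word → Bool

/-- A promise problem assigns to each string the non-empty set of its valid answers. -/
abbrev PromiseProblem : Type := Word → Answers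

/-- A non-promise problem, treated as a promise problem. -/
def Problem.toPromise (φ : Problem) : PromiseProblem :=
  fun w => ⟨{φ w}, Set.singleton_nonempty _⟩

open Classical in
/-- The answer set `S` when the promise `P` holds; both answers are valid when it fails. -/
noncomputable def promise (S : Set Bool) (P : Prop) (h : P → S.Nonempty) : Answers :=
  if hP : P then ⟨S, h hP⟩ else ⟨Set.univ, Set.univ_nonempty⟩

/-! ### Strong (many-one) reductions -/

/-- `μ` is computed by a Turing machine whose running time is bounded by a polynomial in the length
of the input. -/
def PolyTime (μ : Word → Word) : Prop :=
  Nonempty (Turing.TM2ComputableInPolyTime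
    (Subtype.val : Word → List Bool) (Subtype.val : Word → List Bool) μ)

/-- Strong reduction `φ₁ ∝ φ₂`: a polynomial time `μ` with `φ₁ x ⊇ φ₂ (μ x)` for every string. -/
def StrongRed (φ₁ φ₂ : PromiseProblem) : Prop :=
  ∃ μ : Word → Word, PolyTime μ ∧ ∀ w : Word, (φ₂ (μ w) : Set Bool) ⊆ (φ₁ w : Set Bool)

/-- The strong closure `[φ]` of a promise problem. -/
def strongClosure (φ : PromiseProblem) : Set PromiseProblem := {ψ | StrongRed ψ φ}

/-- `φ` is complete for the class `C` under strong reductions. -/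
def IsCompleteFor (φ : PromiseProblem) (C : Set PromiseProblem) : Prop :=
  φ ∈ C ∧ ∀ ψ ∈ C, StrongRed ψ φ

/-! ### Boolean functions of `n` blocks of variables -/

/-- A function `f : Σ^{m₁} × ⋯ × Σ^{mₙ} → Σ` with all `mᵢ ≥ 1`.  The `i`-th block has length
`len i`, where `i` is counted from `0`. -/
structure BlockFun (n : ℕ) where
  len : Fin n → ℕ
  len_pos : ∀ i, 0 < len i
  toFun : ((i : Fin n) → (Fin (len i) → Bool)) → Bool

/-- The function `f_x` obtained from `f` by fixing the first block to be `x`. -/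
def BlockFun.fix {n : ℕ} (f : BlockFun (n + 1)) (x : Fin (f.len 0) → Bool) : BlockFun n where
  len := fun i => f.len i.succ
  len_pos := fun i => f.len_pos i.succ
  toFun := fun y => f.toFun (Fin.cons (α := fun i => Fin (f.len i) → Bool) x y)

mutual

/-- `∃ x, ∀ y⁽¹⁾, ∃ y⁽²⁾, …, f (x, y⁽¹⁾, y⁽²⁾, …) = 1`. -/
def IsSat : (n : ℕ) → BlockFun n → Prop
  | 0, f => f.toFun (fun i => i.elim0) = true
  | n + 1, f => ∃ x : Fin (f.len 0) → Bool, IsTaut n (f.fix x)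

/-- `∀ x, ∃ y⁽¹⁾, ∀ y⁽²⁾, …, f (x, y⁽¹⁾, y⁽²⁾, …) = 1`. -/
def IsTaut : (n : ℕ) → BlockFun n → Prop
  | 0, f => f.toFun (fun i => i.elim0) = true
  | n + 1, f => ∀ x : Fin (f.len 0) → Bool, IsSat n (f.fix x)

end

/-- The set of the first bits `π₁ x` of the witnesses `x` of `f`. -/
def firstBits {n : ℕ} (f : BlockFun (n + 1)) : Set Bool :=
  {b | ∃ x : Fin (f.len 0) → Bool, IsTaut n (f.fix x) ∧ x ⟨0, f.len_pos 0⟩ = b}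

theorem firstBits_nonempty {n : ℕ} (f : BlockFun (n + 1)) (h : IsSat (n + 1) f) :
    (firstBits f).Nonempty := by
  rw [IsSat] at h
  obtain ⟨x, hx⟩ := h
  exact ⟨_, x, hx, rfl⟩

/-! ### Boolean expressions and their encoding by strings -/

/-- Boolean expressions; `var i j` is the `j`-th variable of the `i`-th block, both counted
from `0`. -/
inductive Expr : Type
  | var (i j : ℕ) : Expr
  | not (e : Expr) : Expr
  | and (e₁ e₂ : Expr) : Expr
  | or (e₁ e₂ : Expr) : Expr

/-- The value of an expression under an assignment. -/
def Expr.eval (v : ℕ → ℕ → Bool) : Expr → Bool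
  | .var i j => v i j
  | .not e => !(e.eval v)
  | .and e₁ e₂ => e₁.eval v && e₂.eval v
  | .or e₁ e₂ => e₁.eval v || e₂.eval v

/-- The least number `m` such that all variables of the `i`-th block that occur in the expression
are among the first `m` variables of that block. -/
def Expr.bound (i : ℕ) : Expr → ℕ
  | .var i' j => if i' = i then j + 1 else 0
  | .not e => e.bound i
  | .and e₁ e₂ => max (e₁.bound i) (e₂.bound i)
  | .or e₁ e₂ => max (e₁.bound i) (e₂.bound i)

/-- The function of blocks of lengths `m i` given by an expression.  (Variables outside these
blocks are read as `0`.) -/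
def BlockFun.ofExpr {n : ℕ} (m : Fin n → ℕ) (hm : ∀ i, 0 < m i) (e : Expr) : BlockFun n where
  len := m
  len_pos := hm
  toFun := fun x => e.eval fun i j =>
    if h : ∃ hi : i < n, j < m ⟨i, hi⟩ then x ⟨i, h.1⟩ ⟨j, h.2⟩ else false

/-- Self-delimiting binary code of a number: the binary digits, least significant first, each
preceded by the bit `1`, and then the bit `0`. -/
def codeNat (m : ℕ) : List Bool := m.bits.flatMap (fun b => [true, b]) ++ [false]

/-- Code of an expression in prefix notation. -/
def codeExpr : Expr → List Bool
  | .var i j => false :: false :: (codeNat i ++ codeNat j)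
  | .not e => false :: true :: codeExpr e
  | .and e₁ e₂ => true :: false :: (codeExpr e₁ ++ codeExpr e₂)
  | .or e₁ e₂ => true :: true :: (codeExpr e₁ ++ codeExpr e₂)

/-- An instance is encoded by its expression, followed by the block lengths in binary. -/
def encode {n : ℕ} (m : Fin n → ℕ) (e : Expr) : List Bool :=
  codeExpr e ++ (List.ofFn m).flatMap codeNat

/-- Reads a number from the front of a string, and returns it with the rest of the string. -/
def readNat : List Bool → ℕ × List Bool
  | true :: b :: s => (b.toNat + 2 * (readNat s).1, (readNat s).2)
  | false :: s => (0, s)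
  | _ => (0, [])

/-- Reads an expression from the front of a string, and returns it with the rest of the string.
Missing subexpressions at the end of the string are read as the first variable of the first block.
The first argument is fuel; the length of the string suffices. -/
def readExpr : ℕ → List Bool → Expr × List Bool
  | _ + 1, false :: false :: s =>
      (.var (readNat s).1 (readNat (readNat s).2).1, (readNat (readNat s).2).2)
  | k + 1, false :: true :: s => (.not (readExpr k s).1, (readExpr k s).2)
  | k + 1, true :: false :: s =>
      (.and (readExpr k s).1 (readExpr k (readExpr k s).2).1, (readExpr k (readExpr k s).2).2)
  | k + 1, true :: true :: s =>
      (.or (readExpr k s).1 (readExpr k (readExpr k s).2).1, (readExpr k (readExpr k s).2).2)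
  | _, _ => (.var 0 0, [])

/-- The `i`-th number (counted from `0`) in a string that lists numbers. -/
def readNth : ℕ → List Bool → ℕ
  | 0, s => (readNat s).1
  | i + 1, s => readNth i (readNat s).2

/-- The function encoded by a string: an expression is read, and then the block lengths.  So that
every string encodes a function, a listed block length that is `0`, or smaller than the index of a
variable that occurs, is replaced by the least admissible one. -/
def decode (n : ℕ) (s : List Bool) : BlockFun n :=
  BlockFun.ofExpr
    (fun i => max 1 (max ((readExpr s.length s).1.bound i) (readNth i (readExpr s.length s).2)))
    (fun _ => lt_of_lt_of_le Nat.zero_lt_one (le_max_left _ _))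
    (readExpr s.length s).1

theorem readNat_codeNat (m : ℕ) (s : List Bool) : readNat (codeNat m ++ s) = (m, s) := by
  induction m using Nat.binaryRec' generalizing s with
  | zero => simp [codeNat, readNat]
  | bit b k h ih =>
    have := ih s
    simp only [codeNat] at this ⊢
    rw [Nat.bits_append_bit _ _ h]
    simp only [List.flatMap_cons, List.cons_append, List.nil_append, List.append_assoc] at this ⊢
    rw [readNat, this]
    simp [Nat.bit_val, add_comm]

theorem readExpr_codeExpr (e : Expr) (s : List Bool) (k : ℕ) (hk : (codeExpr e).length ≤ k) :
    readExpr k (codeExpr e ++ s) = (e, s) := by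
  induction e generalizing s k with
  | var i j =>
    obtain _ | k := k
    · simp [codeExpr] at hk
    · simp [codeExpr, readExpr, readNat_codeNat]
  | not e ih =>
    obtain _ | k := k
    · simp [codeExpr] at hk
    · simp only [codeExpr, List.length_cons] at hk
      simp [codeExpr, readExpr, ih s k (by omega)]
  | and e₁ e₂ ih₁ ih₂ =>
    obtain _ | k := k
    · simp [codeExpr] at hk
    · simp only [codeExpr, List.length_cons, List.length_append] at hk
      simp [codeExpr, readExpr, ih₁ _ k (by omega), ih₂ _ k (by omega)]
  | or e₁ e₂ ih₁ ih₂ =>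
    obtain _ | k := k
    · simp [codeExpr] at hk
    · simp only [codeExpr, List.length_cons, List.length_append] at hk
      simp [codeExpr, readExpr, ih₁ _ k (by omega), ih₂ _ k (by omega)]

theorem readNth_flatMap (l : List ℕ) (i : ℕ) (hi : i < l.length) :
    readNth i (l.flatMap codeNat) = l[i] := by
  induction l generalizing i with
  | nil => simp at hi
  | cons a l ih =>
    cases i with
    | zero => simp [readNth, readNat_codeNat]
    | succ i => simpa [readNth, readNat_codeNat] using ih i (by simpa using hi)

/-- `decode` inverts `encode`, for all block lengths and all expressions in these variables. -/
theorem decode_encode {n : ℕ} (m : Fin n → ℕ) (hm : ∀ i, 0 < m i) (e : Expr)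
    (he : ∀ i : Fin n, e.bound i ≤ m i) : decode n (encode m e) = BlockFun.ofExpr m hm e := by
  have h : readExpr (encode m e).length (encode m e) = (e, (List.ofFn m).flatMap codeNat) :=
    readExpr_codeExpr _ _ _ (by simp [encode])
  have h2 : (fun i : Fin n => max 1 (max (e.bound i)
      (readNth i ((List.ofFn m).flatMap codeNat)))) = m := by
    funext i
    rw [readNth_flatMap _ _ (by simp)]
    simp only [List.getElem_ofFn, Fin.eta]
    rw [max_eq_right (he i), max_eq_right (hm i)]
  simp only [decode, h]
  congr 1

/-! ### The complete problems and the classes -/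

open Classical in
/-- `SAT_n`. -/
noncomputable def SAT (n : ℕ) : Problem := fun w => decide (IsSat n (decode n w.1))

open Classical in
/-- The dual problem of `SAT_n`, with the quantifiers `∀ ∃ ∀ ⋯`. -/
noncomputable def coSAT (n : ℕ) : Problem := fun w => decide (IsTaut n (decode n w.1))

/-- `VAL_n`: find the first bit of some witness.  It is meant for `n ≥ 1`; the value at `n = 0` is
a placeholder. -/
noncomputable def VAL : ℕ → PromiseProblem
  | 0 => fun _ => ⟨Set.univ, Set.univ_nonempty⟩
  | n + 1 => fun w => promise (firstBits (decode (n + 1) w.1)) (IsSat (n + 1) (decode (n + 1) w.1))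
      (firstBits_nonempty _)

/-- promise-`Σ_n`, the strong closure of `SAT_n`. -/
noncomputable def SigmaHat (n : ℕ) : Set PromiseProblem := strongClosure (SAT n).toPromise

/-- promise-`Π_n`, the strong closure of the dual of `SAT_n`. -/
noncomputable def PiHat (n : ℕ) : Set PromiseProblem := strongClosure (coSAT n).toPromise

/-- The strong closure of `VAL_n`. -/
noncomputable def VHat (n : ℕ) : Set PromiseProblem := strongClosure (VAL n)

end PromiseHierarchy

/-!
`VAL_n` reduces to `SAT_n` and to its dual since, for a function `F` with first variable `y`, one
may answer `1` exactly if `y ∧ F` is satisfiable, or exactly if `y ∨ ¬F` is a tautology.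
Conversely, let `φ` reduce to both problems, with instances `F` of `SAT_n` and `G` of its dual.
Rename the variables of `F` and `G` apart from `y`. Then the witnesses of `(y ∧ F) ∨ ¬(y ∨ G)`
with `y = 1` are those of `F`, the ones with `y = 0` are the counterexamples to `G`, and so every
valid answer of `VAL_n` is the answer to `F` or to `G`. Renaming the `j`-th variable of every
block to the one with number `2 * j + 1` merely inserts one digit per number into the code, which
a machine does in linear time; unused variables do not matter, so quantification over finite
blocks can be replaced by quantification over infinite ones.
-/

namespace PromiseHierarchy

open Turing Turing.TM2

/-! ### Multi-stack programs -/

/-- `StepsIn f t a b`: iterating the partial function `f` leads from `a` to `b` in exactly `t`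
steps. -/
inductive StepsIn {α : Type*} (f : α → Option α) : ℕ → α → α → Prop
  | refl (a : α) : StepsIn f 0 a a
  | head {t : ℕ} {a b c : α} : f a = some b → StepsIn f t b c → StepsIn f (t + 1) a c

namespace StepsIn

variable {α β : Type*} {f : α → Option α} {s t : ℕ} {a b c : α}

theorem single (h : f a = some b) : StepsIn f 1 a b := .head h (.refl b)

theorem trans (h₁ : StepsIn f s a b) (h₂ : StepsIn f t b c) : StepsIn f (s + t) a c := by
  induction h₁ with
  | refl => simpa using h₂
  | head h _ ih => simpa only [Nat.add_right_comm] using head h (ih h₂)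

theorem iff_iterate : StepsIn f t a b ↔ (flip bind f)^[t] (some a) = some b := by
  induction t generalizing a with
  | zero => exact ⟨by rintro ⟨⟩; rfl, by rintro ⟨⟩; exact .refl _⟩
  | succ t ih =>
    rw [Function.iterate_succ_apply, show flip bind f (some a) = f a from rfl]
    constructor
    · rintro (_ | ⟨h, h'⟩)
      rw [h]
      exact ih.1 h'
    · cases h : f a with
      | none =>
        rw [Function.iterate_fixed (show flip bind f none = none from rfl)]
        exact nofun
      | some c => exact fun h' => .head h (ih.2 h')

theorem simulate {g : β → Option β} {R : α → β → Prop}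
    (hR : ∀ a a' b, f a = some a' → R a b → ∃ b', g b = some b' ∧ R a' b')
    (h : StepsIn f t a c) {d : β} (hd : R a d) : ∃ d', StepsIn g t d d' ∧ R c d' := by
  induction h generalizing d with
  | refl => exact ⟨d, .refl d, hd⟩
  | head h _ ih =>
    obtain ⟨d₁, hd₁, hR₁⟩ := hR _ _ _ h hd
    obtain ⟨d', hd', hR'⟩ := ih hR₁
    exact ⟨d', .head hd₁ hd', hR'⟩

theorem le_add_mul {φ : α → ℕ} {C : ℕ} (hφ : ∀ a b, f a = some b → φ b ≤ φ a + C)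
    (h : StepsIn f t a b) : φ b ≤ φ a + C * t := by
  induction h with
  | refl => simp
  | head h _ ih =>
    have := hφ _ _ h
    rw [mul_add_one]
    omega

end StepsIn

/-- A finite multi-stack program: a `Turing.FinTM2` without designated input and output stacks,
so that programs on the same stacks can be composed. -/
structure Prog {K : Type} (Γ : K → Type) where
  Λ : Type
  [fintypeΛ : Fintype Λ]
  main : Λ
  σ : Type
  [fintypeσ : Fintype σ]
  init : σ
  m : Λ → Stmt Γ Λ σ

attribute [instance] Prog.fintypeΛ Prog.fintypeσ

/-- `P.Run S S' t`: the program `P` turns the stacks `S` into `S'` in at most `t` steps. As in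
`Turing.TM2Outputs`, it has to halt in its initial state. -/
def Prog.Run {K : Type} [DecidableEq K] {Γ : K → Type} (P : Prog Γ) (S S' : ∀ k, List (Γ k))
    (t : ℕ) : Prop :=
  ∃ s ≤ t, StepsIn (step P.m) s ⟨some P.main, P.init, S⟩ ⟨none, P.init, S'⟩

/-! ### Programs as parts of larger programs -/

/-- An embedding of the stacks with alphabets `Δ` into the stacks with alphabets `Γ`, with a coding
of the letters. -/
structure StackEmbedding {L K : Type} (Δ : L → Type) (Γ : K → Type) where
  stack : L → K
  stack_injective : Function.Injective stack
  enc : ∀ k, Δ k → Γ (stack k)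
  dec : ∀ k, Γ (stack k) → Δ k
  dec_enc : ∀ k, Function.LeftInverse (dec k) (enc k)

namespace StackEmbedding

variable {L K : Type} {Δ : L → Type} {Γ : K → Type} {ι : StackEmbedding Δ Γ}
  {S₀ S S' : ∀ k, List (Γ k)} {A A' : ∀ k, List (Δ k)}

/-- The identity embedding. -/
def refl (Γ : K → Type) : StackEmbedding Γ Γ :=
  ⟨id, Function.injective_id, fun _ => id, fun _ => id, fun _ _ => rfl⟩

/-- The contents `S` of the larger family of stacks consist of the coded contents `A` of the
smaller one and, elsewhere, of `S₀`. -/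
structure Represents (ι : StackEmbedding Δ Γ) (S₀ : ∀ k, List (Γ k)) (A : ∀ k, List (Δ k))
    (S : ∀ k, List (Γ k)) : Prop where
  stack : ∀ k, S (ι.stack k) = (A k).map (ι.enc k)
  frame : ∀ k, (∀ l, ι.stack l ≠ k) → S k = S₀ k

theorem represents_refl (S₀ S : ∀ k, List (Γ k)) : (refl Γ).Represents S₀ S S :=
  ⟨fun k => (List.map_id (S k)).symm, fun k hk => absurd rfl (hk k)⟩

theorem Represents.unique (h : ι.Represents S₀ A S) (h' : ι.Represents S₀ A S') : S = S' := by
  funext k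
  by_cases hk : ∃ l, ι.stack l = k
  · obtain ⟨l, rfl⟩ := hk
    rw [h.stack, h'.stack]
  · rw [h.frame k (not_exists.1 hk), h'.frame k (not_exists.1 hk)]

theorem Represents.update [DecidableEq L] [DecidableEq K] (h : ι.Represents S₀ A S) (k : L)
    (l : List (Δ k)) : ι.Represents S₀ (Function.update A k l)
      (Function.update S (ι.stack k) (l.map (ι.enc k))) where
  stack k' := by
    by_cases hk : k' = k
    · subst hk
      simp only [Function.update_self]
    · rw [Function.update_of_ne (ι.stack_injective.ne hk), Function.update_of_ne hk, h.stack]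
  frame k' hk' := by rw [Function.update_of_ne (hk' k).symm, h.frame k' hk']

theorem Represents.map_dec_head? (h : ι.Represents S₀ A S) (k : L) :
    (S (ι.stack k)).head?.map (ι.dec k) = (A k).head? := by
  rw [h.stack, ← List.head?_map, List.map_map, (ι.dec_enc k).comp_eq_id, List.map_id]

end StackEmbedding

/-- The data to run a program as a part of a larger one: where its stacks, labels and states are
found in the larger program, and the label `next` (none to halt) to jump to when it halts. -/
structure Embedding {L K : Type} (Δ : L → Type) (Γ : K → Type) (Λ σ Λ' σ' : Type) extends
    StackEmbedding Δ Γ where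
  label : Λ → Λ'
  next : Option Λ'
  get : σ' → σ
  set : σ' → σ → σ'
  get_set : ∀ s a, get (set s a) = a
  set_set : ∀ s a b, set (set s a) b = set s b

namespace Embedding

variable {L K : Type} {Δ : L → Type} {Γ : K → Type} {Λ σ Λ' σ' : Type}

/-- A statement of the smaller program as one of the larger program. -/
def stmt (E : Embedding Δ Γ Λ σ Λ' σ') : Stmt Δ Λ σ → Stmt Γ Λ' σ'
  | .push k f q => .push (E.stack k) (fun s => E.enc k (f (E.get s))) (E.stmt q)
  | .peek k f q =>
    .peek (E.stack k) (fun s o => E.set s (f (E.get s) (o.map (E.dec k)))) (E.stmt q)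
  | .pop k f q =>
    .pop (E.stack k) (fun s o => E.set s (f (E.get s) (o.map (E.dec k)))) (E.stmt q)
  | .load f q => .load (fun s => E.set s (f (E.get s))) (E.stmt q)
  | .branch f q₁ q₂ => .branch (fun s => f (E.get s)) (E.stmt q₁) (E.stmt q₂)
  | .goto l => .goto (fun s => E.label (l (E.get s)))
  | .halt => E.next.elim .halt fun l => .goto fun _ => l

/-- The configuration `d` of the larger program corresponds to `c`; the state `v₀` and the stacks
`S₀` describe the part that the smaller program does not see. -/
structure Simulates (E : Embedding Δ Γ Λ σ Λ' σ') (v₀ : σ') (S₀ : ∀ k, List (Γ k))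
    (c : Cfg Δ Λ σ) (d : Cfg Γ Λ' σ') : Prop where
  label : d.l = c.l.elim E.next fun l => some (E.label l)
  state : d.var = E.set v₀ c.var
  represents : E.Represents S₀ c.stk d.stk

variable [DecidableEq L] [DecidableEq K] (E : Embedding Δ Γ Λ σ Λ' σ') {v₀ : σ'}
  {S₀ : ∀ k, List (Γ k)}

theorem simulates_stepAux (q : Stmt Δ Λ σ) (v : σ) {A : ∀ k, List (Δ k)} {S : ∀ k, List (Γ k)}
    (h : E.Represents S₀ A S) :
    E.Simulates v₀ S₀ (stepAux q v A) (stepAux (E.stmt q) (E.set v₀ v) S) := by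
  induction q generalizing v A S with
  | push k f q ih =>
    simpa only [stmt, stepAux, E.get_set, h.stack, List.map_cons] using
      ih v (h.update k (f v :: A k))
  | peek k f q ih =>
    simpa only [stmt, stepAux, E.get_set, E.set_set, h.map_dec_head?] using ih _ h
  | pop k f q ih =>
    simp only [stmt, stepAux, E.get_set, E.set_set, h.map_dec_head?]
    rw [h.stack, ← List.map_tail]
    exact ih _ (h.update k (A k).tail)
  | load f q ih => simpa only [stmt, stepAux, E.get_set, E.set_set] using ih _ h
  | branch f q₁ q₂ ih₁ ih₂ =>
    simp only [stmt, stepAux, E.get_set]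
    cases f v
    · exact ih₂ v h
    · exact ih₁ v h
  | goto l => exact ⟨by simp only [stmt, stepAux, E.get_set, Option.elim], rfl, h⟩
  | halt => cases hn : E.next <;> exact ⟨by simp [stmt, stepAux, hn], by simp [stmt, stepAux, hn],
      by simpa [stmt, stepAux, hn] using h⟩

theorem stepsIn {m : Λ → Stmt Δ Λ σ} {M : Λ' → Stmt Γ Λ' σ'}
    (hM : ∀ l, M (E.label l) = E.stmt (m l)) {t : ℕ} {l : Λ} {v v' : σ} {A A' : ∀ k, List (Δ k)}
    (h : StepsIn (step m) t ⟨some l, v, A⟩ ⟨none, v', A'⟩) (v₀ : σ') {S S' : ∀ k, List (Γ k)}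
    (hS : E.Represents S A S) (hS' : E.Represents S A' S') :
    StepsIn (step M) t ⟨some (E.label l), E.set v₀ v, S⟩ ⟨E.next, E.set v₀ v', S'⟩ := by
  have step_simulated : ∀ c c' d, step m c = some c' → E.Simulates v₀ S c d →
      ∃ d', step M d = some d' ∧ E.Simulates v₀ S c' d' := by
    rintro ⟨_ | l, v, A⟩ c' ⟨l', u, T⟩ hc ⟨hl, hu, hT⟩
    · cases hc
    · cases hc
      cases hl
      cases hu
      exact ⟨_, congrArg some (congrArg (stepAux · _ T) (hM l)), E.simulates_stepAux (m l) v hT⟩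
  obtain ⟨⟨l', u, T⟩, hd, hl, hu, hT⟩ := h.simulate step_simulated
    (d := ⟨some (E.label l), E.set v₀ v, S⟩) ⟨rfl, rfl, hS⟩
  cases hl
  cases hu
  cases hT.unique hS'
  exact hd

end Embedding

namespace Prog

variable {K : Type} [DecidableEq K] {Γ : K → Type}

/-- The embedding of the first part of a sequential composition, which continues with the second
part. -/
def seqLeft (P Q : Prog Γ) : Embedding Γ Γ P.Λ P.σ (P.Λ ⊕ Q.Λ) (P.σ × Q.σ) where
  toStackEmbedding := .refl Γ
  label := .inl
  next := some (.inr Q.main)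
  get := Prod.fst
  set s a := (a, s.2)
  get_set _ _ := rfl
  set_set _ _ _ := rfl

/-- The embedding of the second part of a sequential composition. -/
def seqRight (P Q : Prog Γ) : Embedding Γ Γ Q.Λ Q.σ (P.Λ ⊕ Q.Λ) (P.σ × Q.σ) where
  toStackEmbedding := .refl Γ
  label := .inr
  next := none
  get := Prod.snd
  set s a := (s.1, a)
  get_set _ _ := rfl
  set_set _ _ _ := rfl

/-- Sequential composition of programs. -/
def seq (P Q : Prog Γ) : Prog Γ where
  Λ := P.Λ ⊕ Q.Λ
  main := .inl P.main
  σ := P.σ × Q.σ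
  init := (P.init, Q.init)
  m := Sum.elim (fun l => (seqLeft P Q).stmt (P.m l)) (fun l => (seqRight P Q).stmt (Q.m l))

theorem Run.seq {P Q : Prog Γ} {S S' S'' : ∀ k, List (Γ k)} {s t : ℕ} (h₁ : P.Run S S' s)
    (h₂ : Q.Run S' S'' t) : (P.seq Q).Run S S'' (s + t) := by
  obtain ⟨s', hs, h₁⟩ := h₁
  obtain ⟨t', ht, h₂⟩ := h₂
  exact ⟨s' + t', add_le_add hs ht, .trans
    ((seqLeft P Q).stepsIn (M := (P.seq Q).m) (fun _ => rfl) h₁ (P.init, Q.init)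
      (StackEmbedding.represents_refl S S) (StackEmbedding.represents_refl S S'))
    ((seqRight P Q).stepsIn (M := (P.seq Q).m) (fun _ => rfl) h₂ (P.init, Q.init)
      (StackEmbedding.represents_refl S' S') (StackEmbedding.represents_refl S' S''))⟩

variable {L : Type} [DecidableEq L] {Δ : L → Type}

/-- The embedding of a program with more stacks. -/
def liftEmbedding (P : Prog Δ) (ι : StackEmbedding Δ Γ) : Embedding Δ Γ P.Λ P.σ P.Λ P.σ where
  toStackEmbedding := ι
  label := id
  next := none
  get := id
  set _ a := a
  get_set _ _ := rfl
  set_set _ _ _ := rfl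

/-- The program `P` on some of the stacks of a larger family. -/
def lift (P : Prog Δ) (ι : StackEmbedding Δ Γ) : Prog Γ where
  Λ := P.Λ
  main := P.main
  σ := P.σ
  init := P.init
  m l := (P.liftEmbedding ι).stmt (P.m l)

theorem Run.lift {P : Prog Δ} {ι : StackEmbedding Δ Γ} {t : ℕ} {A A' : ∀ k, List (Δ k)}
    {S S' : ∀ k, List (Γ k)} (h : P.Run A A' t) (hS : ι.Represents S A S)
    (hS' : ι.Represents S A' S') : (P.lift ι).Run S S' t := by
  obtain ⟨s, hs, h⟩ := h
  exact ⟨s, hs, (P.liftEmbedding ι).stepsIn (fun _ => rfl) h P.init hS hS'⟩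

end Prog

/-! ### Copying and writing -/

section Statements

variable {K : Type} [DecidableEq K] {Γ : K → Type} {Λ σ : Type}

/-- Pushes the letters of `l` on the stack `a`, one after the other. -/
def pushList (a : K) (l : List (Γ a)) (q : Stmt Γ Λ σ) : Stmt Γ Λ σ :=
  l.foldr (fun x q => .push a (fun _ => x) q) q

theorem stepAux_pushList (a : K) (l : List (Γ a)) (q : Stmt Γ Λ σ) (v : σ)
    (S : ∀ k, List (Γ k)) :
    stepAux (pushList a l q) v S = stepAux q v (Function.update S a (l.reverse ++ S a)) := by
  induction l generalizing S with
  | nil => simp [pushList]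
  | cons x l ih => simpa [pushList, stepAux] using ih (Function.update S a (x :: S a))

/-- Pushes the letter `f v`, recoded, on every stack of the list `T`. -/
def pushEach (T : List (Σ k, Bool → Γ k)) (f : σ → Bool) (q : Stmt Γ Λ σ) : Stmt Γ Λ σ :=
  T.foldr (fun x q => .push x.1 (fun v => x.2 (f v)) q) q

theorem exists_stepAux_pushEach {T : List (Σ k, Bool → Γ k)} (hT : (T.map Sigma.fst).Nodup)
    (f : σ → Bool) (q : Stmt Γ Λ σ) (v : σ) (S : ∀ k, List (Γ k)) :
    ∃ S', stepAux (pushEach T f q) v S = stepAux q v S' ∧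
      (∀ x ∈ T, S' x.1 = x.2 (f v) :: S x.1) ∧ ∀ k, k ∉ T.map Sigma.fst → S' k = S k := by
  induction T generalizing S with
  | nil => exact ⟨S, rfl, nofun, fun _ _ => rfl⟩
  | cons x T ih =>
    rw [List.map_cons, List.nodup_cons] at hT
    obtain ⟨S', hS', mem, notMem⟩ := ih hT.2 (Function.update S x.1 (x.2 (f v) :: S x.1))
    refine ⟨S', hS', List.forall_mem_cons.2 ⟨?_, fun y hy => ?_⟩, fun k hk => ?_⟩
    · rw [notMem x.1 hT.1, Function.update_self]
    · rw [mem y hy, Function.update_of_ne]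
      exact fun hyx => hT.1 (hyx ▸ List.mem_map_of_mem hy)
    · rw [List.map_cons, List.mem_cons, not_or] at hk
      rw [notMem k hk.2, Function.update_of_ne hk.1]

end Statements

namespace Prog

variable {K : Type} [DecidableEq K] {Γ : K → Type}

/-- Pushes the letters of `l` on the stack `a`, one after the other. -/
def write (a : K) (l : List (Γ a)) : Prog Γ where
  Λ := Unit
  main := ()
  σ := Unit
  init := ()
  m _ := pushList a l .halt

theorem run_write (a : K) (l : List (Γ a)) (S : ∀ k, List (Γ k)) :
    (write a l).Run S (Function.update S a (l.reverse ++ S a)) 1 :=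
  ⟨1, le_rfl, .single (congrArg some (stepAux_pushList a l .halt () S))⟩

/-- Empties the stack `a`; the letters taken from it are read as bits by `e` and pushed, recoded,
on every stack of the list `T`. -/
def pour (a : K) (e : Γ a → Bool) (T : List (Σ k, Bool → Γ k)) : Prog Γ where
  Λ := Unit
  main := ()
  σ := Option Bool
  init := none
  m _ := .pop a (fun _ o => o.map e) <| .branch Option.isSome
    (pushEach T (Option.getD · false) <| .goto fun _ => ()) .halt

theorem run_pour {a : K} {e : Γ a → Bool} {T : List (Σ k, Bool → Γ k)}
    (hT : (a :: T.map Sigma.fst).Nodup) {S S' : ∀ k, List (Γ k)} (ha : S' a = [])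
    (h : ∀ x ∈ T, S' x.1 = ((S a).map fun c => x.2 (e c)).reverse ++ S x.1)
    (h' : ∀ k, k ∉ a :: T.map Sigma.fst → S' k = S k) :
    (pour a e T).Run S S' ((S a).length + 1) := by
  refine ⟨_, le_rfl, ?_⟩
  suffices ∀ v, StepsIn (step (pour a e T).m) ((S a).length + 1) ⟨some (), v, S⟩ ⟨none, none, S'⟩
    from this none
  have haT := (List.nodup_cons.1 hT).1
  generalize hl : S a = l at h ⊢
  induction l generalizing S with
  | nil =>
    have hS : S' = S := by
      funext k
      by_cases hk : k ∈ a :: T.map Sigma.fst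
      · obtain rfl | hk := List.mem_cons.1 hk
        · rw [ha, hl]
        · obtain ⟨x, hx, rfl⟩ := List.mem_map.1 hk
          rw [h x hx, List.map_nil, List.reverse_nil, List.nil_append]
      · exact h' k hk
    subst hS
    have pop_nil : Function.update S' a [] = S' := by rw [← ha, Function.update_eq_self]
    exact fun v => .single (by simp only [step, pour, stepAux, hl, List.tail_nil, pop_nil]; rfl)
  | cons c l ih =>
    intro v
    obtain ⟨S₁, hS₁, mem, notMem⟩ := exists_stepAux_pushEach (List.nodup_cons.1 hT).2
      (Option.getD · false) (.goto fun _ => ()) (some (e c)) (Function.update S a l)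
    have hk : ∀ k ≠ a, Function.update S a l k = S k := fun k hk => Function.update_of_ne hk l S
    refine .head (b := ⟨some (), some (e c), S₁⟩) ?_ (ih (fun k hk' => ?_) ?_ (fun x hx => ?_) _)
    · simp only [step, pour, stepAux, hl]
      exact congrArg some hS₁
    · rw [List.mem_cons, not_or] at hk'
      rw [notMem k hk'.2, hk k hk'.1]
      exact h' k (by simpa using hk')
    · rw [notMem a haT, Function.update_self]
    · rw [mem x hx, hk x.1 fun hxa => haT (hxa ▸ List.mem_map_of_mem hx), h x hx]
      simp

end Prog

/-- The number of letters that a statement can push. -/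
def pushes {K : Type} {Γ : K → Type} {Λ σ : Type} : Stmt Γ Λ σ → ℕ
  | .push _ _ q => pushes q + 1
  | .peek _ _ q => pushes q
  | .pop _ _ q => pushes q
  | .load _ q => pushes q
  | .branch _ q₁ q₂ => max (pushes q₁) (pushes q₂)
  | .goto _ => 0
  | .halt => 0

section Length

variable {K : Type} [DecidableEq K] {Γ : K → Type}

theorem length_update_le (S : ∀ k, List (Γ k)) {a : K} {l : List (Γ a)} {n : ℕ}
    (h : l.length ≤ (S a).length + n) (k : K) :
    (Function.update S a l k).length ≤ (S k).length + n := by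
  by_cases hk : k = a
  · subst hk
    rwa [Function.update_self]
  · rw [Function.update_of_ne hk]
    exact Nat.le_add_right _ n

theorem length_stepAux_le {Λ σ : Type} (q : Stmt Γ Λ σ) (v : σ) (S : ∀ k, List (Γ k)) (k : K) :
    ((stepAux q v S).stk k).length ≤ (S k).length + pushes q := by
  induction q generalizing v S with
  | push a f q ih =>
    have := length_update_le S (a := a) (l := f v :: S a) (n := 1) le_rfl k
    exact (ih v _).trans (by rw [pushes]; omega)
  | peek a f _ ih => exact ih _ S
  | pop a f _ ih =>
    have := length_update_le S (a := a) (l := (S a).tail) (n := 0) (by simp) k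
    exact (ih _ _).trans (Nat.add_le_add_right this _)
  | load f _ ih => exact ih _ S
  | branch f q₁ q₂ ih₁ ih₂ =>
    simp only [stepAux, pushes]
    cases f v
    · exact (ih₂ v S).trans (Nat.add_le_add_left (le_max_right _ _) _)
    · exact (ih₁ v S).trans (Nat.add_le_add_left (le_max_left _ _) _)
  | goto l => exact le_rfl
  | halt => exact le_rfl

theorem Prog.exists_length_le (P : Prog Γ) :
    ∃ C, ∀ S S' t, P.Run S S' t → ∀ k, (S' k).length ≤ (S k).length + C * t := by
  obtain ⟨C, hC⟩ := (Set.finite_range fun l => pushes (P.m l)).bddAbove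
  refine ⟨C, fun S S' t ⟨s, hs, h⟩ k => ?_⟩
  have length_step_le : ∀ c c', step P.m c = some c' →
      (c'.stk k).length ≤ (c.stk k).length + C := by
    rintro ⟨_ | l, v, T⟩ c' hc
    · cases hc
    · cases hc
      exact (length_stepAux_le (P.m l) v T k).trans (Nat.add_le_add_left (hC ⟨l, rfl⟩) _)
  have := h.le_add_mul (φ := fun c => (c.stk k).length) length_step_le
  exact this.trans (Nat.add_le_add_left (Nat.mul_le_mul_left C hs) _)

end Length

/-! ### Polynomial time routines on registers -/

/-- The number `m w` is bounded by a polynomial in the length of the string `w`. -/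
def PolyBounded (m : Word → ℕ) : Prop :=
  ∃ q : Polynomial ℕ, ∀ w : Word, m w ≤ q.eval w.1.length

namespace PolyBounded

variable {m m₁ m₂ : Word → ℕ}

theorem mono (h₂ : PolyBounded m₂) (h : ∀ w, m₁ w ≤ m₂ w) : PolyBounded m₁ :=
  h₂.imp fun _ hq w => (h w).trans (hq w)

theorem const (c : ℕ) : PolyBounded fun _ => c :=
  ⟨.C c, fun w => by rw [Polynomial.eval_C]⟩

theorem length : PolyBounded fun w => w.1.length :=
  ⟨.X, fun w => by rw [Polynomial.eval_X]⟩

theorem add (h₁ : PolyBounded m₁) (h₂ : PolyBounded m₂) : PolyBounded fun w => m₁ w + m₂ w := by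
  obtain ⟨q₁, h₁⟩ := h₁
  obtain ⟨q₂, h₂⟩ := h₂
  exact ⟨q₁ + q₂, fun w => by simpa using add_le_add (h₁ w) (h₂ w)⟩

theorem const_mul (c : ℕ) (h : PolyBounded m) : PolyBounded fun w => c * m w := by
  obtain ⟨q, h⟩ := h
  exact ⟨.C c * q, fun w => by simpa using Nat.mul_le_mul_left c (h w)⟩

theorem comp (h : PolyBounded m) {g : Word → Word} (hg : PolyBounded fun w => (g w).1.length) :
    PolyBounded (m ∘ g) := by
  obtain ⟨q, h⟩ := h
  obtain ⟨r, hg⟩ := hg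
  have monotone_eval : Monotone q.eval := fun a b hab => by
    simp only [Polynomial.eval_eq_sum, Polynomial.sum]
    gcongr
  exact ⟨q.comp r, fun w => (h (g w)).trans <| by
    rw [Polynomial.eval_comp]
    exact monotone_eval (hg w)⟩

end PolyBounded

/-- The alphabets of a family of stacks that consists of a register of bits for every element of
`U` and of further stacks, with alphabets `Γ`. -/
abbrev Alphabet (U : Type) {K : Type} (Γ : K → Type) : U ⊕ K → Type :=
  Sum.elim (fun _ => Bool) Γ

/-- The joint contents of the registers and of the further stacks. -/
def contents {U K : Type} {Γ : K → Type} (R : U → List Bool) (T : ∀ k, List (Γ k)) :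
    ∀ k, List (Alphabet U Γ k)
  | .inl u => R u
  | .inr k => T k

/-- The embedding of registers and further stacks given by injections of both. -/
def registerEmbedding {U V K L : Type} {f : U → V} (hf : f.Injective) {g : K → L}
    (hg : g.Injective) (Γ : L → Type) :
    StackEmbedding (Alphabet U fun k => Γ (g k)) (Alphabet V Γ) where
  stack := Sum.map f g
  stack_injective := hf.sumMap hg
  enc := Sum.rec (fun _ => id) fun _ => id
  dec := Sum.rec (fun _ => id) fun _ => id
  dec_enc := by rintro (u | k) <;> exact fun _ => rfl

theorem represents_contents {U V K L : Type} {f : U → V} (hf : f.Injective) {g : K → L}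
    (hg : g.Injective) {Γ : L → Type} {R R' : V → List Bool} {T T' : ∀ k, List (Γ k)}
    (hR : ∀ v ∉ Set.range f, R' v = R v) (hT : ∀ k ∉ Set.range g, T' k = T k) :
    (registerEmbedding hf hg Γ).Represents (contents R T)
      (contents (fun u => R' (f u)) fun k => T' (g k)) (contents R' T') where
  stack := by rintro (u | k) <;> exact (List.map_id _).symm
  frame := by
    rintro (v | k) h
    · exact hR v fun ⟨u, hu⟩ => h (.inl u) (congrArg Sum.inl hu)
    · exact hT k fun ⟨l, hl⟩ => h (.inr l) (congrArg Sum.inr hl)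

/-- For every string `w`, the register contents `F w` can be turned into `G w` by one and the same
program, in time polynomial in the length of `w`. The program may use further, private stacks,
which are empty before and after the run. -/
def Routine {U : Type} [DecidableEq U] (F G : Word → U → List Bool) : Prop :=
  ∃ (K : Type) (_ : DecidableEq K) (_ : Finite K) (Γ : K → Type) (P : Prog (Alphabet U Γ))
    (t : Word → ℕ), PolyBounded t ∧
      ∀ w, P.Run (contents (F w) fun _ => []) (contents (G w) fun _ => []) (t w)

namespace Routine

variable {U : Type} [DecidableEq U] {F G H : Word → U → List Bool}

theorem trans (h₁ : Routine F G) (h₂ : Routine G H) : Routine F H := by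
  obtain ⟨K, _, _, Γ, P, s, hs, hP⟩ := h₁
  obtain ⟨L, _, _, Δ, Q, t, ht, hQ⟩ := h₂
  have represents {I : Type} {g : I → K ⊕ L} (hg : g.Injective) (R R' : U → List Bool) :=
    represents_contents Function.injective_id hg (Γ := Sum.elim Γ Δ) (R := R) (R' := R')
      (T := fun _ => []) (T' := fun _ => []) (fun v hv => absurd ⟨v, rfl⟩ hv) fun _ _ => rfl
  exact ⟨K ⊕ L, inferInstance, inferInstance, _, _, _, hs.add ht, fun w =>
    ((hP w).lift (represents Sum.inl_injective _ _) (represents Sum.inl_injective (F w) _)).seq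
      ((hQ w).lift (represents Sum.inr_injective _ _) (represents Sum.inr_injective (G w) _))⟩

theorem comap {g : Word → Word} (h : Routine F G) (hg : PolyBounded fun w => (g w).1.length) :
    Routine (fun w => F (g w)) fun w => G (g w) := by
  obtain ⟨K, _, _, Γ, P, t, ht, hP⟩ := h
  exact ⟨K, inferInstance, inferInstance, Γ, P, _, ht.comp hg, fun w => hP (g w)⟩

theorem frame {V : Type} [DecidableEq V] {f : V → U} (hf : f.Injective)
    (h : Routine (fun w v => F w (f v)) fun w v => G w (f v))
    (hFG : ∀ w, ∀ u ∉ Set.range f, G w u = F w u) : Routine F G := by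
  obtain ⟨K, _, _, Γ, P, t, ht, hP⟩ := h
  refine ⟨K, inferInstance, inferInstance, Γ,
    P.lift (registerEmbedding hf Function.injective_id Γ), t, ht, fun w => (hP w).lift ?_ ?_⟩
  · exact represents_contents hf _ (fun _ _ => rfl) fun _ _ => rfl
  · exact represents_contents hf _ (hFG w) fun _ _ => rfl

theorem polyBounded_length (h : Routine F G) (u : U) (hF : PolyBounded fun w => (F w u).length) :
    PolyBounded fun w => (G w u).length := by
  obtain ⟨K, _, _, Γ, P, t, ht, hP⟩ := h
  obtain ⟨C, hC⟩ := P.exists_length_le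
  exact (hF.add (ht.const_mul C)).mono fun w => hC _ _ _ (hP w) (.inl u)

theorem of_run {P : Prog fun _ : U => Bool} {t : Word → ℕ} (ht : PolyBounded t)
    (h : ∀ w, P.Run (F w) (G w) (t w)) : Routine F G := by
  let ι : StackEmbedding (fun _ : U => Bool) (Alphabet U fun _ : Empty => Bool) :=
    ⟨.inl, Sum.inl_injective, fun _ => id, fun _ => id, fun _ _ => rfl⟩
  have represents (S₀ R) : ι.Represents S₀ R (contents R fun _ => []) :=
    ⟨fun u => (List.map_id _).symm, by rintro (u | ⟨⟨⟩⟩) h; exact absurd rfl (h u)⟩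
  exact ⟨Empty, inferInstance, inferInstance, fun _ => Bool, P.lift ι, t, ht,
    fun w => (h w).lift (represents _ _) (represents _ _)⟩

theorem write (u : U) (l : List Bool) :
    Routine F fun w => Function.update (F w) u (l.reverse ++ F w u) :=
  of_run (.const 1) fun w => Prog.run_write u l (F w)

theorem pour {u : U} {T : List U} (hT : (u :: T).Nodup)
    (hF : PolyBounded fun w => (F w u).length)
    (hG : ∀ w v, G w v =
      if v = u then [] else if v ∈ T then (F w u).reverse ++ F w v else F w v) :
    Routine F G := by
  have hT' : (T.map fun v => (⟨v, id⟩ : Σ _ : U, Bool → Bool)).map Sigma.fst = T := by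
    rw [List.map_map]
    exact List.map_id T
  have hu : ∀ v ∈ T, v ≠ u := fun v hv hvu => (List.nodup_cons.1 hT).1 (hvu ▸ hv)
  refine of_run (P := .pour u id (T.map fun v => ⟨v, id⟩)) (hF.add (.const 1)) fun w =>
    Prog.run_pour (by rwa [hT']) (by rw [hG, if_pos rfl]) (List.forall_mem_map.2 fun v hv => ?_)
      fun v hv => ?_
  · rw [hG, if_neg (hu v hv), if_pos hv]
    simp
  · rw [hT', List.mem_cons, not_or] at hv
    rw [hG, if_neg hv.1, if_neg hv.2]

end Routine

/-! ### Polynomial time functions -/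

section single

variable {K : Type} [DecidableEq K] {Γ : K → Type}

/-- The stack `a` holds `l`, all the other ones are empty. -/
def single (a : K) (l : List (Γ a)) : ∀ k, List (Γ k) :=
  Function.update (fun _ => []) a l

theorem single_self (a : K) (l : List (Γ a)) : single a l a = l := by
  simp [single]

theorem single_of_ne {a k : K} (h : k ≠ a) (l : List (Γ a)) : single a l k = [] := by
  simp [single, h]

theorem length_single_le (a : K) (l : List (Γ a)) (k : K) : (single a l k).length ≤ l.length := by
  by_cases h : k = a
  · subst h
    rw [single_self]
  · simp [single_of_ne h]

theorem eq_single {S : ∀ k, List (Γ k)} {a : K} {l : List (Γ a)} (ha : S a = l)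
    (h : ∀ k, k ≠ a → S k = []) : S = single a l := by
  funext k
  by_cases hk : k = a
  · subst hk
    rw [ha, single_self]
  · rw [h k hk, single_of_ne hk]

theorem contents_single {U : Type} [DecidableEq U] (u : U) (l : List Bool) :
    contents (single u l) (fun _ => []) = single (Γ := Alphabet U Γ) (.inl u) l := by
  refine eq_single (Γ := Alphabet U Γ) (single_self (Γ := fun _ : U => Bool) u l) ?_
  rintro (v | k) h
  · exact single_of_ne (Γ := fun _ : U => Bool) (fun hv => h (congrArg Sum.inl hv)) l
  · rfl

end single

theorem initList_stk (tm : FinTM2) (l : List (tm.Γ tm.k₀)) :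
    (initList tm l).stk = single tm.k₀ l := by
  exact eq_single (by simp [initList]) fun k h => by simp [initList, h]

theorem haltList_stk (tm : FinTM2) (l : List (tm.Γ tm.k₁)) :
    (haltList tm l).stk = single tm.k₁ l := by
  exact eq_single (by simp [haltList]) fun k h => by simp [haltList, h]

namespace PolyTime

theorem exists_prog {μ : Word → Word} (h : PolyTime μ) :
    ∃ (K : Type) (_ : DecidableEq K) (_ : Finite K) (Γ : K → Type) (P : Prog Γ) (a b : K)
      (e₀ : Bool ≃ Γ a) (e₁ : Bool ≃ Γ b) (t : Word → ℕ), PolyBounded t ∧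
      ∀ w, P.Run (single a (w.1.map e₀))
        (single b ((μ w).1.map e₁)) (t w) := by
  obtain ⟨⟨⟨tm, e₀, e₁⟩, q, h⟩⟩ := h
  have := tm.kFin
  have := tm.ΛFin
  have := tm.σFin
  refine ⟨tm.K, tm.kDecidableEq, inferInstance, tm.Γ, ⟨tm.Λ, tm.main, tm.σ, tm.initialState, tm.m⟩,
    tm.k₀, tm.k₁, e₀.symm, e₁.symm, _, ⟨q, fun w => le_rfl⟩, fun w => ?_⟩
  obtain ⟨⟨s, h⟩, hs⟩ := h w
  refine ⟨s, hs, StepsIn.iff_iterate.2 ?_⟩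
  rw [← initList_stk, ← haltList_stk]
  exact h

theorem of_routine {μ : Word → Word} {U : Type} [DecidableEq U] [Finite U] (a b : U)
    (h : Routine (fun w => single a w.1)
      fun w => single b (μ w).1) : PolyTime μ := by
  obtain ⟨K, _, _, Γ, P, t, ⟨q, hq⟩, hP⟩ := h
  choose s hs hP using hP
  have := Fintype.ofFinite (U ⊕ K)
  have (c : U) : Fintype (Alphabet U Γ (.inl c)) := inferInstanceAs (Fintype Bool)
  let tm : FinTM2 := ⟨.inl a, .inl b, Alphabet U Γ, P.Λ, P.main, P.σ, P.init, P.m⟩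
  refine ⟨⟨⟨tm, .refl Bool, .refl Bool⟩, q, fun w => ?_⟩⟩
  refine ⟨⟨s w, ?_⟩, (hs w).trans (hq w)⟩
  have input : (initList tm (w.1.map id)).stk = contents (single a w.1) fun _ => [] := by
    rw [contents_single, initList_stk]
    exact congrArg (single _) (List.map_id w.1)
  have output : (haltList tm ((μ w).1.map id)).stk = contents (single b (μ w).1) fun _ => [] := by
    rw [contents_single, haltList_stk]
    exact congrArg (single _) (List.map_id (μ w).1)
  have run := StepsIn.iff_iterate.1 (hP w)
  rw [← input, ← output] at run
  exact run

theorem polyBounded_length {μ : Word → Word} (h : PolyTime μ) :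
    PolyBounded fun w => (μ w).1.length := by
  obtain ⟨K, _, _, Γ, P, a, b, e₀, e₁, t, ht, hP⟩ := h.exists_prog
  obtain ⟨C, hC⟩ := P.exists_length_le
  refine (PolyBounded.length.add (ht.const_mul C)).mono fun w => ?_
  have hb := hC _ _ _ (hP w) b
  rw [single_self, List.length_map] at hb
  refine hb.trans (Nat.add_le_add_right ?_ _)
  simpa using length_single_le a (w.1.map e₀) b

theorem routine_reverse {μ : Word → Word} (h : PolyTime μ) :
    Routine (fun w (_ : Unit) => w.1.reverse) fun w _ => (μ w).1.reverse := by
  have hμ := h.polyBounded_length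
  obtain ⟨K, _, _, Γ, P, a, b, e₀, e₁, t, ht, hP⟩ := h.exists_prog
  let Δ := Alphabet Unit Γ
  let ι : StackEmbedding Γ Δ :=
    ⟨.inr, Sum.inr_injective, fun _ => id, fun _ => id, fun _ _ => rfl⟩
  have represents (T₀ T : ∀ k, List (Γ k)) :
      ι.Represents (contents (fun _ => []) T₀) T (contents (fun _ => []) T) :=
    ⟨fun k => (List.map_id _).symm, by rintro (u | k) h; exacts [rfl, absurd rfl (h k)]⟩
  refine ⟨K, inferInstance, inferInstance, Γ,
    ((Prog.pour (Γ := Δ) (.inl ()) id [⟨.inr a, e₀⟩]).seq (P.lift ι)).seq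
      (.pour (Γ := Δ) (.inr b) e₁.symm [⟨.inl (), id⟩]),
    _, ((PolyBounded.length.add (.const 1)).add ht).add (hμ.add (.const 1)), fun w => ?_⟩
  have pour_in : (Prog.pour (Γ := Δ) (.inl ()) id [⟨.inr a, e₀⟩]).Run
      (contents (fun _ => w.1.reverse) fun _ => [])
      (contents (fun _ => []) (single a (w.1.map e₀)))
      (w.1.length + 1) := by
    have run := Prog.run_pour (Γ := Δ) (a := .inl ()) (e := id) (T := [⟨.inr a, e₀⟩]) (by simp)
      (S := contents (fun _ => w.1.reverse) fun _ => [])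
      (S' := contents (fun _ => []) (single a (w.1.map e₀))) rfl ?_ ?_
    · rwa [show (contents (fun _ => w.1.reverse) (fun _ => []) (.inl ())).length = w.1.length from
        w.1.length_reverse] at run
    · rw [List.forall_mem_singleton]
      refine (single_self a _).trans ?_
      change w.1.map e₀ = (w.1.reverse.map e₀).reverse ++ ([] : List (Γ a))
      rw [List.map_reverse, List.reverse_reverse, List.append_nil]
    · rintro (u | k) h
      · simp at h
      · exact single_of_ne (by simpa using h) _
  have pour_out : (Prog.pour (Γ := Δ) (.inr b) e₁.symm [⟨.inl (), id⟩]).Run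
      (contents (fun _ => []) (single b ((μ w).1.map e₁)))
      (contents (fun _ => (μ w).1.reverse) fun _ => []) ((μ w).1.length + 1) := by
    have run := Prog.run_pour (Γ := Δ) (a := .inr b) (e := e₁.symm) (T := [⟨.inl (), id⟩]) (by simp)
      (S := contents (fun _ => []) (single b ((μ w).1.map e₁)))
      (S' := contents (fun _ => (μ w).1.reverse) fun _ => []) rfl ?_ ?_
    · rwa [show (contents (fun _ : Unit => []) (single b ((μ w).1.map e₁)) (.inr b)).length =
        (μ w).1.length from (congrArg _ (single_self b _)).trans (List.length_map _)] at run
    · rw [List.forall_mem_singleton]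
      change (μ w).1.reverse =
        ((single b ((μ w).1.map e₁) b).map fun c => e₁.symm c).reverse ++ ([] : List Bool)
      simp [single_self]
    · rintro (u | k) h
      · simp at h
      · exact (single_of_ne (by simpa using h) _).symm
  exact (pour_in.seq ((hP w).lift (represents _ _) (represents _ _))).seq pour_out

theorem routine_update {μ : Word → Word} (h : PolyTime μ) {U : Type} [DecidableEq U] {u v : U}
    (huv : u ≠ v) {F G : Word → U → List Bool} (hu : ∀ w, F w u = w.1) (hv : ∀ w, F w v = [])
    (hG : ∀ w, G w = Function.update (F w) u (μ w).1) : Routine F G := by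
  have pour_in : Routine F fun w =>
      Function.update (Function.update (F w) u []) v w.1.reverse :=
    .pour (u := u) (T := [v]) (by simp [huv]) (by simpa only [hu] using .length) fun w k => by
      by_cases hku : k = u
      · subst hku
        simp [huv]
      · by_cases hkv : k = v
        · subst hkv
          simp [hku, hu, hv]
        · simp [hku, hkv]
  have run : Routine (fun w => Function.update (Function.update (F w) u []) v w.1.reverse)
      fun w => Function.update (Function.update (F w) u []) v (μ w).1.reverse :=
    .frame (f := fun _ : Unit => v) (fun _ _ _ => rfl) (by simpa using h.routine_reverse)
      fun w k hk => by
        have hkv : k ≠ v := fun hkv => hk ⟨(), hkv.symm⟩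
        simp [hkv]
  refine (pour_in.trans run).trans (.pour (u := v) (T := [u]) (by simp [huv.symm])
    (by simpa using h.polyBounded_length) fun w k => ?_)
  by_cases hkv : k = v
  · subst hkv
    simp [hG, hv, huv.symm]
  · by_cases hku : k = u
    · subst hku
      simp [hG, huv]
    · simp [hG, hku, hkv]

theorem routine_single {μ : Word → Word} (h : PolyTime μ) :
    Routine (fun w => single (0 : Fin 2) w.1) fun w => single 0 (μ w).1 :=
  h.routine_update (u := 0) (v := 1) (by simp) (fun w => single_self _ _)
    (fun w => single_of_ne (by simp) _) fun w => (Function.update_idem _ _ _).symm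

theorem comp {ν μ : Word → Word} (hν : PolyTime ν) (hμ : PolyTime μ) : PolyTime (ν ∘ μ) :=
  of_routine 0 0 (hμ.routine_single.trans (hν.routine_single.comap hμ.polyBounded_length))

theorem const (v : Word) : PolyTime fun _ => v := by
  have clear : Routine (fun w => single () w.1) fun _ _ => [] :=
    .pour (u := ()) (T := []) (by simp) (by simpa only [single_self] using .length) fun _ _ => rfl
  refine of_routine () () (clear.trans ?_)
  convert Routine.write () v.1.reverse using 2
  simp [single]

theorem id : PolyTime _root_.id := ⟨idComputableInPolyTime _⟩

end PolyTime

/-- Concatenation of strings. -/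
def Word.append (v w : Word) : Word := ⟨v.1 ++ w.1, List.append_ne_nil_of_left_ne_nil v.2 _⟩

theorem PolyTime.append {μ ν : Word → Word} (hμ : PolyTime μ) (hν : PolyTime ν) :
    PolyTime fun w => (μ w).append (ν w) := by
  have single_zero (l : List Bool) : single (0 : Fin 3) l = ![l, [], []] := by
    funext k
    fin_cases k <;> rfl
  have single_one (l : List Bool) : single (1 : Fin 3) l = ![[], l, []] := by
    funext k
    fin_cases k <;> rfl
  have copy_in : Routine (fun w => ![w.1, [], []]) fun w => ![[], [], w.1.reverse] :=
    .pour (u := 0) (T := [2]) (by decide) .length fun w k => by fin_cases k <;> simp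
  have copy_out : Routine (fun w => ![[], [], w.1.reverse]) fun w => ![w.1, w.1, []] :=
    .pour (u := 2) (T := [0, 1]) (by decide) (by simpa using .length) fun w k => by
      fin_cases k <;> simp
  have run_left : Routine (fun w => ![w.1, w.1, []]) fun w => ![(μ w).1, w.1, []] :=
    hμ.routine_update (u := 0) (v := 2) (by decide) (fun _ => rfl) (fun _ => rfl) fun w => by
      funext k
      fin_cases k <;> rfl
  have run_right : Routine (fun w => ![(μ w).1, w.1, []]) fun w => ![(μ w).1, (ν w).1, []] :=
    hν.routine_update (u := 1) (v := 2) (by decide) (fun _ => rfl) (fun _ => rfl) fun w => by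
      funext k
      fin_cases k <;> rfl
  have append_in : Routine (fun w => ![(μ w).1, (ν w).1, []])
      fun w => ![[], (ν w).1, (μ w).1.reverse] :=
    .pour (u := 0) (T := [2]) (by decide) hμ.polyBounded_length fun w k => by fin_cases k <;> simp
  have append_out : Routine (fun w => ![[], (ν w).1, (μ w).1.reverse])
      fun w => ![[], (μ w).1 ++ (ν w).1, []] :=
    .pour (u := 2) (T := [1]) (by decide) (by simpa using hμ.polyBounded_length) fun w k => by
      fin_cases k <;> simp
  refine of_routine (0 : Fin 3) 1 ?_
  simp only [single_zero, single_one, Word.append]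
  exact ((copy_in.trans copy_out).trans (run_left.trans run_right)).trans
    (append_in.trans append_out)

/-! ### Codes of expressions -/

/-- The conjunction or, if `b` is true, the disjunction of two expressions. -/
def Expr.conn (b : Bool) (e₁ e₂ : Expr) : Expr := cond b (.or e₁ e₂) (.and e₁ e₂)

theorem readExpr_true (k : ℕ) (b : Bool) (s : List Bool) :
    readExpr (k + 1) (true :: b :: s) =
      (.conn b (readExpr k s).1 (readExpr k (readExpr k s).2).1,
        (readExpr k (readExpr k s).2).2) := by
  cases b <;> rfl

theorem length_readNat_le (s : List Bool) : (readNat s).2.length ≤ s.length := by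
  fun_induction readNat s <;> grind

theorem length_readExpr_le (k : ℕ) (s : List Bool) : (readExpr k s).2.length ≤ s.length := by
  fun_induction readExpr k s <;> grind [length_readNat_le]

theorem readExpr_of_length_le_one (k : ℕ) {s : List Bool} (hs : s.length ≤ 1) :
    readExpr k s = (.var 0 0, []) := by
  match s, hs with
  | [], _ | [_], _ => cases k <;> simp [readExpr]

theorem readExpr_eq_of_length_le {k l : ℕ} {s : List Bool} (hk : s.length ≤ k)
    (hl : s.length ≤ l) : readExpr k s = readExpr l s := by
  by_cases hs : s.length ≤ 1
  · rw [readExpr_of_length_le_one k hs, readExpr_of_length_le_one l hs]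
  fun_induction readExpr k s generalizing l with
  | case5 k s =>
    rcases s with _ | ⟨_ | _, _ | ⟨_ | _, s⟩⟩ <;> cases k <;> simp_all
  | _ => cases l <;> grind [length_readExpr_le, readExpr, readExpr_of_length_le_one]

/-- The expression at the front of a string. -/
def exprOf (w : List Bool) : Expr := (readExpr w.length w).1

/-- The string `o` is a self-delimiting code of the expression `e`. -/
def Codes (o : List Bool) (e : Expr) : Prop :=
  ∀ k u, o.length ≤ k → readExpr k (o ++ u) = (e, u)

namespace Codes

variable {o o₁ o₂ : List Bool} {e e₁ e₂ : Expr}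

theorem var {i j : ℕ} (h₁ : ∀ u, readNat (o₁ ++ u) = (i, u))
    (h₂ : ∀ u, readNat (o₂ ++ u) = (j, u)) :
    Codes (false :: false :: (o₁ ++ o₂)) (.var i j) := by
  rintro (_ | k) u hk
  · simp at hk
  · simp [readExpr, h₁, h₂]

theorem not (h : Codes o e) : Codes (false :: true :: o) (.not e) := by
  rintro (_ | k) u hk
  · simp at hk
  · simp only [List.length_cons] at hk
    simp [readExpr, h k u (by omega)]

theorem conn (b : Bool) (h₁ : Codes o₁ e₁) (h₂ : Codes o₂ e₂) :
    Codes (true :: b :: (o₁ ++ o₂)) (.conn b e₁ e₂) := by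
  rintro (_ | k) u hk
  · simp at hk
  · simp only [List.length_cons, List.length_append] at hk
    simp [readExpr_true, h₁ k _ (by omega), h₂ k u (by omega)]

theorem exprOf_eq (h : Codes o e) : exprOf o = e := by
  simpa [exprOf] using congrArg Prod.fst (h o.length [] le_rfl)

end Codes

namespace Word

/-- A code of the first variable of the first block. -/
def firstVar : Word := ⟨[false, false, false, false], by simp⟩

/-- Negation on codes of expressions. -/
def not (w : Word) : Word := append ⟨[false, true], by simp⟩ w

/-- `Expr.conn` on codes of expressions. -/
def conn (b : Bool) (v w : Word) : Word := append ⟨[true, b], by simp⟩ (append v w)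

theorem codes_firstVar : Codes firstVar.1 (.var 0 0) :=
  .var (o₁ := [false]) (o₂ := [false]) (fun _ => rfl) fun _ => rfl

theorem exprOf_not (w : Word) : exprOf w.not.1 = .not (exprOf w.1) := by
  simp only [exprOf, not, append, List.cons_append, List.nil_append, List.length_cons, readExpr]
  rw [readExpr_eq_of_length_le (Nat.le_succ _) le_rfl]

theorem exprOf_conn (b : Bool) {v : Word} {e : Expr} (h : Codes v.1 e) (w : Word) :
    exprOf (conn b v w).1 = .conn b e (exprOf w.1) := by
  simp only [exprOf, conn, append, List.cons_append, List.nil_append, List.length_cons,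
    readExpr_true, List.length_append]
  rw [h _ w.1 (by omega), readExpr_eq_of_length_le (s := w.1) (by omega) le_rfl]

end Word

/-- The expression in which the `j`-th variable of every block is replaced by the one with number
`2 * j + 1`. -/
def Expr.odd : Expr → Expr
  | .var i j => .var i (2 * j + 1)
  | .not e => .not e.odd
  | .and e₁ e₂ => .and e₁.odd e₂.odd
  | .or e₁ e₂ => .or e₁.odd e₂.odd

theorem Expr.odd_conn (b : Bool) (e₁ e₂ : Expr) : (conn b e₁ e₂).odd = conn b e₁.odd e₂.odd := by
  cases b <;> rfl

/-- The part of a string that `readNat` reads, properly terminated. -/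
def copyNat : List Bool → List Bool
  | true :: b :: s => true :: b :: copyNat s
  | _ => [false]

theorem readNat_copyNat (s u : List Bool) : readNat (copyNat s ++ u) = ((readNat s).1, u) := by
  fun_induction copyNat s with
  | case1 b s ih => simp [readNat, ih]
  | case2 s h =>
    match s, h with
    | [], _ | [true], _ | false :: _, _ => rfl
    | true :: b :: s, h => exact absurd rfl (h b s)

/-- A code of `(readExpr k s).1.odd`. Missing subexpressions, which are read as `.var 0 0`, become
codes of `.var 0 1`. -/
def oddCode : ℕ → List Bool → List Bool
  | _ + 1, false :: false :: s =>
    false :: false :: (copyNat s ++ (true :: true :: copyNat (readNat s).2))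
  | k + 1, false :: true :: s => false :: true :: oddCode k s
  | k + 1, true :: b :: s => true :: b :: (oddCode k s ++ oddCode k (readExpr k s).2)
  | _, _ => [false, false, false, true, true, false]

theorem codes_oddCode (k : ℕ) (s : List Bool) : Codes (oddCode k s) (readExpr k s).1.odd := by
  fun_induction oddCode k s with
  | case1 _ s =>
    exact .var (readNat_copyNat s) fun u => by simp [readNat, readNat_copyNat, add_comm]
  | case2 k s ih => exact ih.not
  | case3 k b s ih₁ ih₂ =>
    rw [readExpr_true, Expr.odd_conn]
    exact ih₁.conn b ih₂
  | case4 k s h₁ h₂ h₃ =>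
    have missing : readExpr k s = (.var 0 0, []) := by rw [readExpr] <;> simp_all
    rw [missing]
    exact .var (o₁ := [false]) (o₂ := [true, true, false]) (fun u => rfl) fun u => rfl

/-! ### A parser -/

/-- The stacks of the parser: the rest of the input, one letter for every subexpression that is
still to be read, and the output in reverse. -/
inductive Stack
  | inp
  | todo
  | out
  deriving DecidableEq

namespace Stack

instance : Fintype Stack := ⟨{inp, todo, out}, by rintro (_ | _ | _) <;> decide⟩

/-- The stacks with given contents. -/
@[simp]
def tapes (s c r : List Bool) : Stack → List Bool
  | inp => s
  | todo => c
  | out => r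

variable (s c r l : List Bool)

@[simp]
theorem update_inp : Function.update (tapes s c r) .inp l = tapes l c r := by
  funext k
  cases k <;> rfl

@[simp]
theorem update_todo : Function.update (tapes s c r) .todo l = tapes s l r := by
  funext k
  cases k <;> rfl

@[simp]
theorem update_out : Function.update (tapes s c r) .out l = tapes s c l := by
  funext k
  cases k <;> rfl

end Stack

namespace Parser

open Stack

/-- The labels: read an expression, or one of the two numbers of a variable. -/
inductive Label
  | expr
  | num (second : Bool)
  deriving Fintype

/-- Statements of the parser. Its state holds the two letters read last. -/
abbrev Statement : Type := Stmt (fun _ : Stack => Bool) Label (Option Bool × Option Bool)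

/-- Continues at the label `l`, in the initial state. -/
def jump (l : Label) : Statement := .load (fun _ => (none, none)) <| .goto fun _ => l

/-- The letters that separate the first number of a variable from the second one, which thus gets
`1` as an additional least significant digit. -/
def separator : Bool → List Bool
  | false => [true, true]
  | true => []

/-- The label at which the parser continues at the end of a number. -/
def next : Bool → Label
  | false => .num true
  | true => .expr

/-- Ends a number in the output. -/
def endNum (b : Bool) : Statement := pushList .out (false :: separator b) <| jump (next b)

/-- Replaces the expression at the front of the input by its `oddCode`. -/
def prog : Prog fun _ : Stack => Bool where
  Λ := Label
  main := .expr
  σ := Option Bool × Option Bool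
  init := (none, none)
  m
  | .expr =>
    .pop todo (fun _ o => (o, none)) <| .branch (·.1.isSome)
      (.pop inp (fun _ o => (o, none)) <| .pop inp (fun v o => (v.1, o)) <| .branch (·.2.isSome)
        (.push out (·.1.getD false) <| .push out (·.2.getD false) <| .branch (·.1.getD false)
          (pushList todo [false, false] <| jump .expr) <|
          .branch (·.2.getD false)
            (pushList todo [false] <| jump .expr)
            (jump (.num false)))
        (pushList out [false, false, false, true, true, false] <| jump .expr))
      .halt
  | .num b =>
    .pop inp (fun _ o => (o, none)) <| .branch (·.1.getD false)
      (.pop inp (fun v o => (v.1, o)) <| .branch (·.2.isSome)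
        (pushList out [true] <| .push out (·.2.getD false) <| jump (.num b))
        (endNum b))
      (endNum b)

/-- The parser at the label `l`, with given contents of the stacks. -/
def config (l : Label) (s c r : List Bool) : Cfg (fun _ : Stack => Bool) prog.Λ prog.σ :=
  ⟨some l, (none, none), tapes s c r⟩

theorem steps_num (b : Bool) (s c r : List Bool) :
    ∃ t, t + (readNat s).2.length ≤ s.length + 1 ∧ StepsIn (step prog.m) t (config (.num b) s c r)
      (config (next b) (readNat s).2 c ((copyNat s ++ separator b).reverse ++ r)) := by
  fun_induction copyNat s generalizing r with
  | case1 a s ih =>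
    obtain ⟨t, ht, h⟩ := ih (a :: true :: r)
    refine ⟨t + 1, ?_, .head (b := config (.num b) s c (a :: true :: r)) ?_ ?_⟩
    · simp only [readNat, List.length_cons]
      omega
    · simp [config, prog, jump, step, stepAux_pushList]
    · simpa [copyNat, readNat] using h
  | case2 s h =>
    match s, h with
    | [], _ | [true], _ | false :: s, _ =>
      refine ⟨1, by simp [readNat, add_comm], .single ?_⟩
      simp [readNat, config, prog, endNum, jump, step, stepAux_pushList]
    | true :: b :: s, h => exact absurd rfl (h b s)

theorem steps_expr {k : ℕ} {s : List Bool} (hk : s.length ≤ k) (c r : List Bool) :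
    ∃ t, t + (readExpr k s).2.length ≤ s.length + 1 ∧ StepsIn (step prog.m) t
      (config .expr s (false :: c) r)
      (config .expr (readExpr k s).2 c ((oddCode k s).reverse ++ r)) := by
  fun_induction oddCode k s generalizing c r with
  | case1 k s =>
    obtain ⟨t₁, ht₁, h₁⟩ := steps_num false s c (false :: false :: r)
    obtain ⟨t₂, ht₂, h₂⟩ := steps_num true (readNat s).2 c
      ((copyNat s ++ separator false).reverse ++ false :: false :: r)
    refine ⟨t₁ + t₂ + 1, ?_, .head (b := config (.num false) s c (false :: false :: r)) ?_ ?_⟩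
    · simp only [readExpr, List.length_cons]
      omega
    · simp [config, prog, jump, step, stepAux_pushList]
    · simpa [readExpr, separator, next] using h₁.trans h₂
  | case2 k s ih =>
    simp only [List.length_cons] at hk
    obtain ⟨t, ht, h⟩ := ih (by omega) c (true :: false :: r)
    refine ⟨t + 1, ?_, .head (b := config .expr s (false :: c) (true :: false :: r)) ?_ ?_⟩
    · simp only [readExpr, List.length_cons]
      omega
    · simp [config, prog, jump, step, stepAux_pushList]
    · simpa [readExpr] using h
  | case3 k b s ih₁ ih₂ =>
    simp only [List.length_cons] at hk
    obtain ⟨t₁, ht₁, h₁⟩ := ih₁ (by omega) (false :: c) (b :: true :: r)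
    obtain ⟨t₂, ht₂, h₂⟩ := ih₂ ((length_readExpr_le k s).trans (by omega)) c
      ((oddCode k s).reverse ++ b :: true :: r)
    refine ⟨t₁ + t₂ + 1, ?_,
      .head (b := config .expr s (false :: false :: c) (b :: true :: r)) ?_ ?_⟩
    · simp only [readExpr_true, List.length_cons]
      omega
    · simp [config, prog, jump, step, stepAux_pushList]
    · simpa [readExpr_true] using h₁.trans h₂
  | case4 k s h₁ h₂ h₃ =>
    have hs : s.length ≤ 1 := by
      rcases s with _ | ⟨_ | _, _ | ⟨_ | _, s⟩⟩ <;> cases k <;> simp_all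
    rw [readExpr_of_length_le_one k hs]
    refine ⟨1, by simp, .single ?_⟩
    match s, hs with
    | [], _ | [_], _ => simp [config, prog, jump, step, stepAux_pushList]

theorem run_prog (s : List Bool) :
    prog.Run (tapes s [false] [])
      (tapes (readExpr s.length s).2 [] (oddCode s.length s).reverse) (s.length + 2) := by
  obtain ⟨t, ht, h⟩ := steps_expr le_rfl [] []
  rw [List.append_nil] at h
  exact ⟨t + 1, by omega, h.trans (.single (by simp [config, prog, step]))⟩

end Parser

theorem oddCode_ne_nil (k : ℕ) (s : List Bool) : oddCode k s ≠ [] := by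
  fun_cases oddCode k s <;> simp

/-- A code of `Expr.odd` of the expression at the front of a string. -/
def Word.odd (w : Word) : Word := ⟨oddCode w.1.length w.1, oddCode_ne_nil _ _⟩

theorem Word.codes_odd (w : Word) : Codes w.odd.1 (exprOf w.1).odd := codes_oddCode _ _

theorem PolyTime.odd : PolyTime Word.odd := by
  have start : Routine (fun w => Stack.tapes w.1 [] []) fun w => Stack.tapes w.1 [false] [] := by
    simpa using Routine.write (F := fun w => Stack.tapes w.1 [] []) .todo [false]
  have parse : Routine (fun w => Stack.tapes w.1 [false] []) fun w =>
      Stack.tapes (readExpr w.1.length w.1).2 [] (oddCode w.1.length w.1).reverse :=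
    .of_run (.add .length (.const 2)) fun w => Parser.run_prog w.1
  have clear : Routine
      (fun w => Stack.tapes (readExpr w.1.length w.1).2 [] (oddCode w.1.length w.1).reverse)
      fun w => Stack.tapes [] [] (oddCode w.1.length w.1).reverse :=
    .pour (u := .inp) (T := []) (by decide)
      (PolyBounded.length.mono fun w => length_readExpr_le _ _) fun w k => by cases k <;> simp
  have copy : Routine (fun w => Stack.tapes [] [] (oddCode w.1.length w.1).reverse)
      fun w => Stack.tapes w.odd.1 [] [] :=
    .pour (u := .out) (T := [.inp]) (by decide)
      (parse.polyBounded_length .out (.const 0)) fun w k => by cases k <;> simp [Word.odd]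
  have input (l : List Bool) : Stack.tapes l [] [] = single .inp l :=
    eq_single rfl (by rintro (_ | _) h <;> trivial)
  refine of_routine Stack.inp Stack.inp ?_
  simp only [← input]
  exact (start.trans parse).trans (clear.trans copy)

/-! ### Functions of infinite blocks -/

/-- An assignment to the variables of infinitely many infinite blocks. -/
abbrev Assignment : Type := ℕ → ℕ → Bool

/-- The assignment with first row `x`, followed by the rows of `v`. -/
def consRow (x : ℕ → Bool) (v : Assignment) : Assignment
  | 0 => x
  | i + 1 => v i

/-- `IsSat` for functions of `n` infinite blocks; the remaining blocks are read as `0`. By duality,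
the function `f` is a tautology if and only if `¬f` is not satisfiable, so that no mutual recursion
is needed. -/
def InfSat : ℕ → (Assignment → Bool) → Prop
  | 0, F => F (fun _ _ => false) = true
  | n + 1, F => ∃ x : ℕ → Bool, ¬InfSat n fun v => !F (consRow x v)

/-- `IsTaut` for functions of `n` infinite blocks; the remaining blocks are read as `0`. -/
def InfTaut (n : ℕ) (F : Assignment → Bool) : Prop := ¬InfSat n fun v => !F v

/-- `firstBits` for functions of `n + 1` infinite blocks. -/
def infFirstBits (n : ℕ) (F : Assignment → Bool) : Set Bool :=
  {b | ∃ x : ℕ → Bool, InfTaut n (fun v => F (consRow x v)) ∧ x 0 = b}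

section

variable {n : ℕ} {F : Assignment → Bool}

theorem infSat_not : (InfSat n fun v => !F v) ↔ ¬InfTaut n F := by
  simp [InfTaut]

theorem infTaut_succ : InfTaut (n + 1) F ↔ ∀ x, InfSat n fun v => F (consRow x v) := by
  simp [InfTaut, InfSat]

theorem infSat_succ_iff_nonempty : InfSat (n + 1) F ↔ (infFirstBits n F).Nonempty :=
  ⟨fun ⟨x, hx⟩ => ⟨x 0, x, hx, rfl⟩, fun ⟨_, x, hx, _⟩ => ⟨x, hx⟩⟩

theorem infSat_const (b : Bool) : (InfSat n fun _ => b) ↔ b = true := by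
  induction n generalizing b with
  | zero => rfl
  | succ n ih => simp [InfSat, ih]

theorem infSat_beq_and (b : Bool) :
    (InfSat (n + 1) fun v => v 0 0 == b && F v) ↔ b ∈ infFirstBits n F := by
  refine exists_congr fun x => ?_
  by_cases hx : x 0 = b
  · simp [consRow, hx, InfTaut]
  · simp [consRow, hx, beq_false_of_ne hx, infSat_const]

theorem infTaut_or_not :
    (InfTaut (n + 1) fun v => v 0 0 || !F v) ↔ false ∉ infFirstBits n F := by
  simp [InfTaut, ← infSat_beq_and]

theorem infSat_map {ρ : (ℕ → Bool) → ℕ → Bool} (hρ : ρ.Surjective)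
    (h₀ : ρ (fun _ => false) = fun _ => false) :
    (InfSat n fun v => F fun i => ρ (v i)) ↔ InfSat n F := by
  induction n generalizing F with
  | zero => simp only [InfSat, h₀]
  | succ n ih =>
    have map_consRow (x v) : (fun i => ρ (consRow x v i)) = consRow (ρ x) fun i => ρ (v i) := by
      funext i
      cases i <;> rfl
    simp only [InfSat, map_consRow]
    refine Iff.trans (exists_congr fun x => not_congr ?_)
      (hρ.exists (p := fun x => ¬InfSat n fun v => !F (consRow x v))).symm
    exact ih (F := fun v => !F (consRow (ρ x) v))

end

/-- The bits at odd places of a row. -/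
def oddRow (x : ℕ → Bool) (j : ℕ) : Bool := x (2 * j + 1)

theorem exists_oddRow_eq (b : Bool) (y : ℕ → Bool) : ∃ x, oddRow x = y ∧ x 0 = b := by
  refine ⟨fun j => if j = 0 then b else y (j / 2), ?_, rfl⟩
  funext j
  simp [oddRow, show (2 * j + 1) / 2 = j by omega]

theorem oddRow_surjective : oddRow.Surjective := fun y =>
  (exists_oddRow_eq false y).imp fun _ => And.left

theorem Expr.eval_odd (e : Expr) (v : Assignment) :
    e.odd.eval v = e.eval fun i => oddRow (v i) := by
  induction e <;> simp_all [odd, eval, oddRow]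

/-- As the bits of a row at odd places are independent of its first bit, that bit may choose the
function which the others have to satisfy. -/
theorem mem_infFirstBits_choice {n : ℕ} (C : Bool → Assignment → Bool) (b : Bool) :
    (b ∈ infFirstBits n fun v => C (v 0 0) fun i => oddRow (v i)) ↔ InfSat (n + 1) (C b) := by
  have drop_odd (x : ℕ → Bool) :
      (InfTaut n fun v => C (x 0) fun i => oddRow (consRow x v i)) ↔
        InfTaut n fun v => C (x 0) (consRow (oddRow x) v) := by
    have odd_consRow (v) : (fun i => oddRow (consRow x v i)) =
        consRow (oddRow x) fun i => oddRow (v i) := by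
      funext i
      cases i <;> rfl
    simp only [odd_consRow]
    exact not_congr (infSat_map (F := fun v => !C (x 0) (consRow (oddRow x) v))
      oddRow_surjective rfl)
  constructor
  · rintro ⟨x, hx, rfl⟩
    exact ⟨oddRow x, (drop_odd x).1 hx⟩
  · rintro ⟨y, hy⟩
    obtain ⟨x, rfl, rfl⟩ := exists_oddRow_eq b y
    exact ⟨x, (drop_odd x).2 hy, rfl⟩

/-! ### Block lengths do not matter -/

/-- `F` is the extension of `f` to infinite blocks. -/
def Extends {n : ℕ} (f : BlockFun n) (F : Assignment → Bool) : Prop :=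
  ∀ v : Assignment, f.toFun (fun i j => v i j) = F fun i j => if i < n then v i j else false

namespace Extends

variable {n : ℕ} {F : Assignment → Bool}

theorem fix {f : BlockFun (n + 1)} (h : Extends f F) (x : ℕ → Bool) :
    Extends (f.fix fun j => x j) fun v => F (consRow x v) := by
  intro v
  refine Eq.trans (congrArg f.toFun ?_) ((h (consRow x v)).trans (congrArg F ?_))
  · funext i
    cases i using Fin.cases <;> rfl
  · funext i j
    cases i <;> simp [consRow]

theorem restrict_surjective (m : ℕ) :
    Function.Surjective fun (x : ℕ → Bool) (j : Fin m) => x j :=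
  Fin.val_injective.surjective_comp_right

theorem isSat_iff_and_isTaut_iff {f : BlockFun n} (h : Extends f F) :
    (IsSat n f ↔ InfSat n F) ∧ (IsTaut n f ↔ InfTaut n F) := by
  induction n generalizing F with
  | zero =>
    have value : f.toFun (fun i => i.elim0) = F fun _ _ => false := by
      simpa [Subsingleton.elim (fun i => i.elim0) fun (i : Fin 0) (_ : Fin (f.len i)) => false]
        using h fun _ _ => false
    simp [IsSat, IsTaut, InfSat, InfTaut, value]
  | succ n ih =>
    rw [IsSat, IsTaut, (restrict_surjective _).exists, (restrict_surjective _).forall, infTaut_succ]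
    exact ⟨exists_congr fun x => (ih (h.fix x)).2, forall_congr' fun x => (ih (h.fix x)).1⟩

theorem isSat_iff {f : BlockFun n} (h : Extends f F) : IsSat n f ↔ InfSat n F :=
  h.isSat_iff_and_isTaut_iff.1

theorem isTaut_iff {f : BlockFun n} (h : Extends f F) : IsTaut n f ↔ InfTaut n F :=
  h.isSat_iff_and_isTaut_iff.2

theorem firstBits_eq {f : BlockFun (n + 1)} (h : Extends f F) : firstBits f = infFirstBits n F := by
  ext b
  exact (restrict_surjective _).exists.trans <|
    exists_congr fun x => and_congr_left' (h.fix x).isTaut_iff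

end Extends

theorem Expr.eval_congr (e : Expr) {u v : Assignment}
    (h : ∀ i, ∀ j < e.bound i, u i j = v i j) : e.eval u = e.eval v := by
  induction e with
  | var i j => exact h i j (by simp [bound])
  | not e ih => simp only [eval, ih h]
  | and e₁ e₂ ih₁ ih₂ | or e₁ e₂ ih₁ ih₂ =>
    simp only [eval, ih₁ fun i j hj => h i j (lt_max_of_lt_left hj),
      ih₂ fun i j hj => h i j (lt_max_of_lt_right hj)]

theorem extends_decode (n : ℕ) (w : List Bool) : Extends (decode n w) (exprOf w).eval := by
  intro v
  refine Expr.eval_congr _ fun i j hj => ?_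
  have hj' : j < max 1 (max ((readExpr w.length w).1.bound i)
      (readNth i (readExpr w.length w).2)) :=
    lt_max_of_lt_right (lt_max_of_lt_left hj)
  by_cases hi : i < n <;> simp [hi, hj']

theorem SAT_eq_true_iff {n : ℕ} {w : Word} : SAT n w = true ↔ InfSat n (exprOf w.1).eval := by
  simp only [SAT, decide_eq_true_eq, (extends_decode n w.1).isSat_iff]

theorem coSAT_eq_true_iff {n : ℕ} {w : Word} : coSAT n w = true ↔ InfTaut n (exprOf w.1).eval := by
  simp only [coSAT, decide_eq_true_eq, (extends_decode n w.1).isTaut_iff]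

theorem mem_promise_iff {S : Set Bool} {P : Prop} (h : P → S.Nonempty) (hS : S.Nonempty → P)
    (b : Bool) : b ∈ (promise S P h).1 ↔ b ∈ S ∨ (!b) ∉ S := by
  rw [promise]
  split_ifs with hP
  · obtain ⟨c, hc⟩ := h hP
    cases b <;> cases c <;> simp_all
  · have empty : S = ∅ := Set.not_nonempty_iff_eq_empty.1 fun hne => hP (hS hne)
    simp [empty]

theorem mem_VAL_iff {n : ℕ} {w : Word} {b : Bool} : b ∈ (VAL (n + 1) w).1 ↔
    b ∈ infFirstBits n (exprOf w.1).eval ∨ (!b) ∉ infFirstBits n (exprOf w.1).eval := by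
  have h := extends_decode (n + 1) w.1
  rw [← h.firstBits_eq]
  refine mem_promise_iff _ (fun hne => ?_) b
  rwa [h.isSat_iff, infSat_succ_iff_nonempty, ← h.firstBits_eq]

/-! ### Reductions -/

theorem PolyTime.not {μ : Word → Word} (hμ : PolyTime μ) : PolyTime fun w => (μ w).not :=
  (const _).append hμ

theorem PolyTime.conn (b : Bool) {μ ν : Word → Word} (hμ : PolyTime μ) (hν : PolyTime ν) :
    PolyTime fun w => .conn b (μ w) (ν w) :=
  (const _).append (hμ.append hν)

theorem StrongRed.refl (φ : PromiseProblem) : StrongRed φ φ := ⟨id, .id, fun _ => subset_rfl⟩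

theorem StrongRed.trans {φ ψ χ : PromiseProblem} (h₁ : StrongRed φ ψ) (h₂ : StrongRed ψ χ) :
    StrongRed φ χ := by
  obtain ⟨μ, hμ, h₁⟩ := h₁
  obtain ⟨ν, hν, h₂⟩ := h₂
  exact ⟨ν ∘ μ, hν.comp hμ, fun w => (h₂ _).trans (h₁ w)⟩

theorem isCompleteFor_strongClosure (φ : PromiseProblem) : IsCompleteFor φ (strongClosure φ) :=
  ⟨.refl φ, fun _ => id⟩

open Word

theorem VAL_strongRed_SAT (n : ℕ) : StrongRed (VAL (n + 1)) (SAT (n + 1)).toPromise := by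
  refine ⟨fun w => conn false firstVar w, .conn false (.const firstVar) .id, ?_⟩
  rintro w _ rfl
  have eval_eq : (exprOf (conn false firstVar w).1).eval =
      fun v => v 0 0 == true && (exprOf w.1).eval v := by
    funext v
    simp [exprOf_conn false codes_firstVar, Expr.conn, Expr.eval]
  have h : SAT (n + 1) (conn false firstVar w) = true ↔
      true ∈ infFirstBits n (exprOf w.1).eval := by
    rw [SAT_eq_true_iff, eval_eq, infSat_beq_and]
  rw [mem_VAL_iff]
  cases hb : SAT (n + 1) (conn false firstVar w) <;> simp_all

theorem VAL_strongRed_coSAT (n : ℕ) : StrongRed (VAL (n + 1)) (coSAT (n + 1)).toPromise := by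
  refine ⟨fun w => conn true firstVar w.not, .conn true (.const firstVar) (.not .id), ?_⟩
  rintro w _ rfl
  have eval_eq : (exprOf (conn true firstVar w.not).1).eval =
      fun v => v 0 0 || !(exprOf w.1).eval v := by
    funext v
    simp [exprOf_conn true codes_firstVar, exprOf_not, Expr.conn, Expr.eval]
  have h : coSAT (n + 1) (conn true firstVar w.not) = true ↔
      false ∉ infFirstBits n (exprOf w.1).eval := by
    rw [coSAT_eq_true_iff, eval_eq, infTaut_or_not]
  rw [mem_VAL_iff]
  cases hb : coSAT (n + 1) (conn true firstVar w.not) <;> simp_all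

/-- The string encodes `(y ∧ F) ∨ ¬(y ∨ G)`, where `y` is the first variable, and `v` and `w` encode
`F` and `G`, in variables that are renamed apart from `y`. -/
def choice (v w : Word) : Word :=
  conn true (conn false firstVar v.odd) (conn true firstVar w.odd).not

theorem PolyTime.choice {μ ν : Word → Word} (hμ : PolyTime μ) (hν : PolyTime ν) :
    PolyTime fun w => choice (μ w) (ν w) :=
  .conn true (.conn false (.const _) (odd.comp hμ)) (.not (.conn true (.const _) (odd.comp hν)))

theorem eval_choice (v w : Word) (a : Assignment) : (exprOf (choice v w).1).eval a =
    cond (a 0 0) ((exprOf v.1).eval fun i => oddRow (a i))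
      (!(exprOf w.1).eval fun i => oddRow (a i)) := by
  have codes_and : Codes (conn false firstVar v.odd).1 (.conn false (.var 0 0) (exprOf v.1).odd) :=
    codes_firstVar.conn false v.codes_odd
  rw [choice, exprOf_conn true codes_and, exprOf_not, exprOf_conn true codes_firstVar,
    w.codes_odd.exprOf_eq]
  cases h : a 0 0 <;> simp [Expr.conn, Expr.eval, Expr.eval_odd, h]

theorem mem_VAL_choice_iff {n : ℕ} {v w : Word} {b : Bool} :
    b ∈ (VAL (n + 1) (choice v w)).1 ↔ b = SAT (n + 1) v ∨ b = coSAT (n + 1) w := by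
  let C (b : Bool) (a : Assignment) : Bool := cond b ((exprOf v.1).eval a) !(exprOf w.1).eval a
  have eval_eq : (exprOf (choice v w).1).eval = fun a => C (a 0 0) fun i => oddRow (a i) :=
    funext (eval_choice v w)
  have mem_true : true ∈ infFirstBits n (exprOf (choice v w).1).eval ↔ SAT (n + 1) v = true := by
    rw [eval_eq, mem_infFirstBits_choice, SAT_eq_true_iff]
    rfl
  have mem_false : false ∈ infFirstBits n (exprOf (choice v w).1).eval ↔
      ¬coSAT (n + 1) w = true := by
    rw [eval_eq, mem_infFirstBits_choice, coSAT_eq_true_iff]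
    exact infSat_not
  rw [mem_VAL_iff, eq_comm, @eq_comm _ b]
  cases b
  · simp [mem_true, mem_false, or_comm]
  · simp [mem_true, mem_false]

theorem strongRed_VAL {n : ℕ} {φ : PromiseProblem} (h₁ : StrongRed φ (SAT (n + 1)).toPromise)
    (h₂ : StrongRed φ (coSAT (n + 1)).toPromise) : StrongRed φ (VAL (n + 1)) := by
  obtain ⟨μ, hμ, h₁⟩ := h₁
  obtain ⟨ν, hν, h₂⟩ := h₂
  refine ⟨_, hμ.choice hν, fun w b hb => ?_⟩
  rcases mem_VAL_choice_iff.1 hb with rfl | rfl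
  · exact h₁ w rfl
  · exact h₂ w rfl

theorem VHat_eq {n : ℕ} (hn : 1 ≤ n) : VHat n = SigmaHat n ∩ PiHat n := by
  obtain ⟨n, rfl⟩ := Nat.exists_eq_add_of_le' hn
  ext φ
  exact ⟨fun h => ⟨h.trans (VAL_strongRed_SAT n), h.trans (VAL_strongRed_coSAT n)⟩,
    fun ⟨h₁, h₂⟩ => strongRed_VAL h₁ h₂⟩

end PromiseHierarchy

theorem theorem9 (n : ℕ) (hn : 1 ≤ n) :
    PromiseHierarchy.VHat n = PromiseHierarchy.SigmaHat n ∩ PromiseHierarchy.PiHat n ∧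
    PromiseHierarchy.IsCompleteFor (PromiseHierarchy.VAL n)
      (PromiseHierarchy.SigmaHat n ∩ PromiseHierarchy.PiHat n) := by
  have VHat_eq := PromiseHierarchy.VHat_eq hn
  exact ⟨VHat_eq, VHat_eq ▸ PromiseHierarchy.isCompleteFor_strongClosure _⟩
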